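/- Let $\{Y_t\}_{t\ge 0}$ and $\{Z_t\}_{t\ge 0}$ be two independent real-valued Lévy processes on a common probability space (that is: they start at $0$ a.s., are stochastically continuous, have independent and stationary increments, and have right-continuous paths with left limits a.s.), and let $0<q<p$. Let $\{X_t\}_{t\ge 0}$ be the process defined by $X_0=0$ a.s. and, for $n=0,1,2,\dots$, $$X_t=\begin{cases} X_{np}+Y_t-Y_{np} & (np<t\le np+q),\\ X_{np+q}+Z_t-Z_{np+q} & (np+q<t\le (n+1)p).\end{cases}$$ Assume $E|Y_1|<\infty$ and $E|Z_1|<\infty$. Then $Y_q+Z_{p-q}$ is integrable, and $\{X_t\}_{t\ge0}$ is recurrent, meaning that for every $s\ge 0$ $$\liminf_{t\to\infty}|X_t-X_s|=0\quad\text{a.s.},$$ if and only if $E[Y_q+Z_{p-q}]=0$. -/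

import Mathlib

open Set Filter Topology MeasureTheory ProbabilityTheory
open scoped NNReal ENNReal

/-- An additive process (time runs through `[0, ∞)`): it starts at `0` almost surely, has independent
increments, is stochastically continuous, and almost every path is right-continuous with left
limits. -/
structure IsAdditiveProcess {Ω E : Type*} [MeasurableSpace Ω] [NormedAddCommGroup E]
    [MeasurableSpace E] (X : ℝ≥0 → Ω → E) (P : Measure Ω) : Prop where
  measurable : ∀ t, Measurable (X t)
  zero : ∀ᵐ ω ∂P, X 0 ω = 0
  indep : HasIndepIncrements X P
  stochCont : ∀ t, TendstoInMeasure P X (𝓝 t) (X t)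
  cadlag : ∀ᵐ ω ∂P,
    (∀ t, ContinuousWithinAt (fun u => X u ω) (Ici t) t) ∧
    (∀ t, 0 < t → ∃ l : E, Tendsto (fun u => X u ω) (𝓝[<] t) (𝓝 l))

/-- A Lévy process: an additive process with stationary increments. -/
structure IsLevyProcess {Ω E : Type*} [MeasurableSpace Ω] [NormedAddCommGroup E]
    [MeasurableSpace E] (X : ℝ≥0 → Ω → E) (P : Measure Ω) : Prop
    extends IsAdditiveProcess X P where
  stationary : ∀ s t, IdentDistrib (fun ω => X (s + t) ω - X s ω) (fun ω => X t ω - X 0 ω) P P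

/-- Recurrence: for every `s ≥ 0`, almost surely `liminf_{t → ∞} |X_t - X_s| = 0`.
The liminf is taken in `[0, ∞]`, so that it is `∞` on paths tending to infinity. -/
def IsRecurrentProcess {Ω E : Type*} [MeasurableSpace Ω] [NormedAddCommGroup E]
    (X : ℝ≥0 → Ω → E) (P : Measure Ω) : Prop :=
  ∀ s : ℝ≥0, ∀ᵐ ω ∂P, liminf (fun t : ℝ≥0 => ‖X t ω - X s ω‖ₑ) atTop = 0

/-- `X` is the process that starts at `0` and follows alternately the increments of `Y` on the
intervals `(np, np + q]` and the increments of `Z` on the intervals `(np + q, (n + 1)p]`. -/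
structure IsAlternatingProcess {Ω E : Type*} [MeasurableSpace Ω] [NormedAddCommGroup E]
    (p q : ℝ≥0) (Y Z X : ℝ≥0 → Ω → E) (P : Measure Ω) : Prop where
  zero : ∀ᵐ ω ∂P, X 0 ω = 0
  onY : ∀ (n : ℕ) (t : ℝ≥0), n * p < t → t ≤ n * p + q →
    ∀ ω, X t ω = X (n * p) ω + Y t ω - Y (n * p) ω
  onZ : ∀ (n : ℕ) (t : ℝ≥0), n * p + q < t → t ≤ (n + 1) * p →
    ∀ ω, X t ω = X (n * p + q) ω + Z t ω - Z (n * p + q) ω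

/-- The values at the times `np` of the alternating process. -/
def alternatingSkeleton {Ω E : Type*} [NormedAddCommGroup E]
    (p q : ℝ≥0) (Y Z : ℝ≥0 → Ω → E) : ℕ → Ω → E
  | 0, _ => 0
  | n + 1, ω => alternatingSkeleton p q Y Z n ω + (Y (n * p + q) ω - Y (n * p) ω)
      + (Z ((n + 1) * p) ω - Z (n * p + q) ω)

open Classical in
/-- An explicit construction of the alternating process. -/
noncomputable def alternatingProcess {Ω E : Type*} [NormedAddCommGroup E]
    (p q : ℝ≥0) (Y Z : ℝ≥0 → Ω → E) (t : ℝ≥0) (ω : Ω) : E :=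
  if t = 0 then 0
  else if t ≤ (⌈t / p⌉₊ - 1 : ℕ) * p + q then
    alternatingSkeleton p q Y Z (⌈t / p⌉₊ - 1) ω
      + (Y t ω - Y ((⌈t / p⌉₊ - 1 : ℕ) * p) ω)
  else
    alternatingSkeleton p q Y Z (⌈t / p⌉₊ - 1) ω
      + (Y ((⌈t / p⌉₊ - 1 : ℕ) * p + q) ω - Y ((⌈t / p⌉₊ - 1 : ℕ) * p) ω)
      + (Z t ω - Z ((⌈t / p⌉₊ - 1 : ℕ) * p + q) ω)

/-- The period in which a time lies. -/
theorem ceil_div_sub_one_eq {p t : ℝ≥0} (hp : 0 < p) (n : ℕ) (h1 : n * p < t)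
    (h2 : t ≤ (n + 1) * p) : ⌈t / p⌉₊ - 1 = n := by
  have : ⌈t / p⌉₊ = n + 1 := by
    rw [Nat.ceil_eq_iff (by omega)]
    refine ⟨?_, ?_⟩
    · rw [lt_div_iff₀ hp]; simpa using h1
    · rw [div_le_iff₀ hp]; push_cast; exact h2
  omega

/-- The explicit construction takes the skeleton's value at `np`. -/
theorem alternatingProcess_mul {Ω E : Type*} [NormedAddCommGroup E] {p q : ℝ≥0}
    (hqp : q < p) (Y Z : ℝ≥0 → Ω → E) (n : ℕ) (ω : Ω) :
    alternatingProcess p q Y Z (n * p) ω = alternatingSkeleton p q Y Z n ω := by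
  have hp : 0 < p := lt_of_le_of_lt (zero_le) hqp
  cases n with
  | zero => simp [alternatingProcess, alternatingSkeleton]
  | succ m =>
    have e : ((m + 1 : ℕ) : ℝ≥0) * p = (m + 1) * p := by push_cast; rfl
    have hlt : (m : ℝ≥0) * p + q < (m + 1) * p := by
      rw [add_mul, one_mul]; gcongr
    have hc := ceil_div_sub_one_eq hp m (lt_of_le_of_lt le_self_add hlt) le_rfl
    have h0 : ((m : ℝ≥0) + 1) * p ≠ 0 := by positivity
    rw [e, alternatingProcess, if_neg h0, hc, if_neg (not_le.2 hlt), alternatingSkeleton]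

/-- The alternating process exists. -/
theorem isAlternatingProcess_alternatingProcess {Ω E : Type*} [MeasurableSpace Ω]
    [NormedAddCommGroup E] {p q : ℝ≥0} (hq : 0 < q) (hqp : q < p) (Y Z : ℝ≥0 → Ω → E)
    (P : Measure Ω) :
    IsAlternatingProcess p q Y Z (alternatingProcess p q Y Z) P := by
  have hp : 0 < p := hq.trans hqp
  have hlt : ∀ n : ℕ, (n : ℝ≥0) * p + q < (n + 1) * p := fun n => by
    rw [add_mul, one_mul]; gcongr
  have onY : ∀ (n : ℕ) (t : ℝ≥0), n * p < t → t ≤ n * p + q → ∀ ω,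
      alternatingProcess p q Y Z t ω
        = alternatingProcess p q Y Z (n * p) ω + Y t ω - Y (n * p) ω := by
    intro n t h1 h2 ω
    rw [alternatingProcess_mul hqp, alternatingProcess, if_neg (lt_of_le_of_lt zero_le h1).ne',
      ceil_div_sub_one_eq hp n h1 (h2.trans (hlt n).le), if_pos h2]
    abel
  refine ⟨by simp [alternatingProcess], onY, ?_⟩
  intro n t h1 h2 ω
  have h3 : (n : ℝ≥0) * p < t := lt_of_le_of_lt le_self_add h1
  rw [onY n (n * p + q) (lt_add_of_pos_right _ hq) le_rfl, alternatingProcess_mul hqp,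
    alternatingProcess, if_neg (lt_of_le_of_lt zero_le h3).ne',
    ceil_div_sub_one_eq hp n h3 h2, if_neg (not_le.2 h1)]
  abel

/-! Sampled at the times `s + k * p`, the process is a random walk: over each period it runs through
one full stretch of `Y` and one of `Z`, one of them cut in two by the phase of `s`. Its steps are
therefore i.i.d. with mean `m = E[Y_q + Z_{p-q}]`, whatever `s` is (`increments_iid`).

If `m = 0`, the walk is recurrent (`ae_frequently_abs_sum_lt`), and visits along `s + k * p` already
make the liminf vanish. Recurrence comes from the strong law by counting: the positions at times of
no later `ε`-return are `ε`-separated, while the first `n` positions lie in an interval of length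
`o(n)`. Such times have density zero, and by stationarity this density has expectation equal to the
probability of never returning.

If `m ≠ 0`, the strong law gives `|X_{np}|` linear growth. Within a period the fluctuations are
`o(n)`: Ottaviani's inequality bounds the tail of a supremum by that of an endpoint increment, and
integrability makes these tails summable for Borel–Cantelli. So `|X_t - X_0|` stays away from zero
at all large times, not only along the skeleton. -/

/-! ### Deterministic facts about real sequences. -/

/-- A set of indices at which a real sequence is `ε`-separated and bounded by `M` has at most
`2 * M / ε + 2` elements. -/
theorem card_le_of_separated {ι : Type*} (s : Finset ι) (x : ι → ℝ) {ε M : ℝ} (hε : 0 < ε)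
    (hsep : ∀ i ∈ s, ∀ j ∈ s, i ≠ j → ε ≤ |x i - x j|) (hM : ∀ i ∈ s, |x i| ≤ M) (hM0 : 0 ≤ M) :
    (s.card : ℝ) ≤ 2 * M / ε + 2 := by
  have hcard : s.card ≤ (Finset.Icc ⌊-M / ε⌋ ⌊M / ε⌋).card := by
    -- Two values in the same cell of width `ε` differ by less than `ε`, so each cell holds at most
    -- one index.
    refine Finset.card_le_card_of_injOn (fun i => ⌊x i / ε⌋) ?_ ?_
    · intro i hi
      have h := abs_le.1 (hM i hi)
      simp only [Finset.coe_Icc, Set.mem_Icc]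
      constructor <;> apply Int.floor_le_floor <;> gcongr <;> linarith
    · intro i hi j hj hij
      by_contra hne
      have h1 := Int.abs_sub_lt_one_of_floor_eq_floor hij
      rw [← sub_div, abs_div, abs_of_pos hε, div_lt_one hε] at h1
      exact absurd (hsep i hi j hj hne) (not_le.2 h1)
  rw [Int.card_Icc] at hcard
  have hle : ⌊-M / ε⌋ ≤ ⌊M / ε⌋ := by
    apply Int.floor_le_floor
    gcongr
    linarith
  have h2 : (s.card : ℤ) ≤ ⌊M / ε⌋ + 1 - ⌊-M / ε⌋ := by
    have := Int.toNat_of_nonneg (a := ⌊M / ε⌋ + 1 - ⌊-M / ε⌋) (by linarith)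
    rw [← this]
    exact_mod_cast hcard
  have h3 : (s.card : ℝ) ≤ ⌊M / ε⌋ + 1 - ⌊-M / ε⌋ := by exact_mod_cast h2
  have h4 := Int.floor_le (M / ε)
  have h5 := Int.lt_floor_add_one (-M / ε)
  have h6 : 2 * M / ε = M / ε - -M / ε := by ring
  linarith

/-- If `S n / n → 0`, the partial maxima of `|S|` are `o(n)`. -/
theorem exists_bound_of_tendsto_div_zero {S : ℕ → ℝ}
    (h : Tendsto (fun n : ℕ => S n / n) atTop (𝓝 0)) {δ : ℝ} (hδ : 0 < δ) :
    ∃ C, 0 ≤ C ∧ ∀ n, |S n| ≤ C + δ * n := by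
  obtain ⟨N, hN⟩ := (Metric.tendsto_atTop.1 h) δ hδ
  -- The sum dominates each of the finitely many terms not yet controlled by the limit.
  refine ⟨∑ i ∈ Finset.range (N + 1), |S i|, Finset.sum_nonneg fun _ _ => abs_nonneg _,
    fun n => ?_⟩
  rcases le_or_gt n N with hn | hn
  · have := Finset.single_le_sum (f := fun i => |S i|) (fun i _ => abs_nonneg _)
      (Finset.mem_range.2 (Nat.lt_succ_of_le hn))
    have h2 : 0 ≤ δ * n := by positivity
    linarith
  · have h1 := hN n hn.le
    have hn0 : (0 : ℝ) < n := by exact_mod_cast (Nat.zero_le N).trans_lt hn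
    rw [dist_zero_right, Real.norm_eq_abs, abs_div, abs_of_pos hn0, div_lt_iff₀ hn0] at h1
    have : 0 ≤ ∑ i ∈ Finset.range (N + 1), |S i| := Finset.sum_nonneg fun _ _ => abs_nonneg _
    linarith

/-- A sequence started at zero that from each index comes back arbitrarily close to the current
value comes back arbitrarily close to zero infinitely often. -/
theorem frequently_abs_lt_of_returns {S : ℕ → ℝ} (h0 : S 0 = 0)
    (h : ∀ ε > 0, ∀ i, ∃ n, 1 ≤ n ∧ |S (i + n) - S i| < ε) {ε : ℝ} (hε : 0 < ε) :
    ∃ᶠ n in atTop, |S n| < ε := by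
  rw [frequently_atTop]
  intro K
  -- `ε` stays free: a visit past `K` within `ε / 2` of zero, followed by an `ε / 2`-return to the
  -- value reached, is a visit past `K + 1` within `ε`.
  induction K generalizing ε with
  | zero => exact ⟨0, le_rfl, by simpa [h0] using hε⟩
  | succ K ih =>
    obtain ⟨n, hn, hS⟩ := ih (half_pos hε)
    obtain ⟨m, hm, hS'⟩ := h _ (half_pos hε) n
    refine ⟨n + m, by omega, ?_⟩
    have := abs_add_le (S (n + m) - S n) (S n)
    rw [sub_add_cancel] at this
    linarith

/-! ### Recurrence of centred random walks. -/

section RandomWalk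

variable {Ω : Type*} [MeasurableSpace Ω] {P : Measure Ω}

/-- All the shifts of an i.i.d. sequence have the same law. -/
theorem identDistrib_shift {D : ℕ → Ω → ℝ} (hind : iIndepFun D P)
    (hid : ∀ k, IdentDistrib (D k) (D 0) P P) (i : ℕ) :
    IdentDistrib (fun ω j => D (i + j) ω) (fun ω j => D j ω) P P :=
  IdentDistrib.pi (X := fun j => D (i + j)) (fun j => (hid (i + j)).trans (hid j).symm)
    (hind.precomp (g := fun j => i + j) (add_right_injective i)) hind

variable [IsProbabilityMeasure P]

/-- For an i.i.d. centred sequence, almost surely the partial sums come back near their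
starting point. -/
theorem measure_never_return_eq_zero {D : ℕ → Ω → ℝ} (hmeas : ∀ k, Measurable (D k))
    (hind : iIndepFun D P) (hid : ∀ k, IdentDistrib (D k) (D 0) P P)
    (hint : Integrable (D 0) P) (hmean : ∫ ω, D 0 ω ∂P = 0) {ε : ℝ} (hε : 0 < ε) (i : ℕ) :
    P {ω | ∀ n, 1 ≤ n → ε ≤ |∑ j ∈ Finset.range n, D (i + j) ω|} = 0 := by
  -- The no-return event is taken in path space, so that equality in law of the shifted sequences
  -- gives all `A i` the same probability.
  set B : Set (ℕ → ℝ) := {x | ∀ n, 1 ≤ n → ε ≤ |∑ j ∈ Finset.range n, x j|} with hB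
  have hBm : MeasurableSet B := by
    simp only [hB, Set.ofPred_forall]
    refine MeasurableSet.iInter fun n => MeasurableSet.iInter fun _ => ?_
    exact measurableSet_le measurable_const (by fun_prop)
  set A : ℕ → Set Ω := fun i => (fun ω j => D (i + j) ω) ⁻¹' B with hA
  have hAm : ∀ i, MeasurableSet (A i) := fun i => by
    refine hBm.preimage (by fun_prop)
  have hPA : ∀ i, P.real (A i) = P.real (A 0) := fun i => by
    have h1 := (identDistrib_shift hind hid i).measure_mem_eq hBm
    have h2 := (identDistrib_shift hind hid 0).measure_mem_eq hBm
    simp only [Measure.real, hA]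
    rw [h1, h2]
  -- `F n` is the proportion of no-return times before `n`. Its mean is `P.real (A 0)` for every `n
  -- ≥ 1`, so it suffices that it tends to zero almost surely.
  set F : ℕ → Ω → ℝ := fun n ω => (∑ k ∈ Finset.range n, (A k).indicator 1 ω) / n with hF
  have hFint : ∀ n : ℕ, 1 ≤ n → ∫ ω, F n ω ∂P = P.real (A 0) := by
    intro n hn
    simp only [hF]
    rw [integral_div, integral_finsetSum]
    · simp only [integral_indicator_one (hAm _), hPA]
      simp only [Finset.sum_const, Finset.card_range, nsmul_eq_mul]
      have : (n : ℝ) ≠ 0 := by positivity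
      field_simp
    · intro k _
      exact (integrable_const (1 : ℝ)).indicator (hAm k)
  have hslln := strong_law_ae_real D hint (fun a b hab => hind.indepFun hab) hid
  rw [hmean] at hslln
  have hlim : ∀ᵐ ω ∂P, Tendsto (fun n => F n ω) atTop (𝓝 0) := by
    filter_upwards [hslln] with ω hω
    set S : ℕ → ℝ := fun n => ∑ k ∈ Finset.range n, D k ω with hS
    have hdiff : ∀ i n, S (i + n) - S i = ∑ j ∈ Finset.range n, D (i + j) ω := by
      intro i n
      simp only [hS]
      rw [Finset.sum_range_add]
      ring
    have hcount : ∀ (n : ℕ) (M : ℝ), 0 ≤ M → (∀ k < n, |S k| ≤ M) →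
        ∑ k ∈ Finset.range n, (A k).indicator (1 : Ω → ℝ) ω ≤ 2 * M / ε + 2 := by
      classical
      intro n M hM0 hM
      have e : ∑ k ∈ Finset.range n, (A k).indicator (1 : Ω → ℝ) ω
          = (((Finset.range n).filter fun k => ω ∈ A k).card : ℝ) := by
        simp [indicator_apply]
      rw [e]
      have key : ∀ i j, ω ∈ A i → i < j → ε ≤ |S j - S i| := by
        intro i j hi hij
        have := hi (j - i) (by omega)
        rw [← hdiff, show i + (j - i) = j by omega] at this
        exact this
      refine card_le_of_separated _ S hε ?_ ?_ hM0
      · intro i hi j hj hij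
        simp only [Finset.mem_filter] at hi hj
        rcases lt_or_gt_of_ne hij with h | h
        · rw [abs_sub_comm]; exact key i j hi.2 h
        · exact key j i hj.2 h
      · intro i hi
        simp only [Finset.mem_filter, Finset.mem_range] at hi
        exact hM i hi.1
    rw [Metric.tendsto_atTop]
    intro η hη
    -- With this slope the count is at most `n * (η / 2)` plus a constant, which the other half of
    -- `η * n` absorbs.
    obtain ⟨C, hC0, hC⟩ := exists_bound_of_tendsto_div_zero hω (δ := η * ε / 4) (by positivity)
    have hlarge : Tendsto (fun n : ℕ => (n : ℝ) * (η / 2)) atTop atTop :=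
      tendsto_natCast_atTop_atTop.atTop_mul_const (by positivity)
    obtain ⟨N, hN⟩ := ((hlarge.eventually_gt_atTop (2 * C / ε + 2)).and
      (eventually_ge_atTop 1)).exists_forall_of_atTop
    refine ⟨N, fun n hn => ?_⟩
    obtain ⟨h1, h2⟩ := hN n hn
    have hn0 : (0 : ℝ) < n := by exact_mod_cast h2
    have hnn : 0 ≤ ∑ k ∈ Finset.range n, (A k).indicator (1 : Ω → ℝ) ω :=
      Finset.sum_nonneg fun k _ => indicator_nonneg (by simp) _
    rw [dist_zero_right, Real.norm_eq_abs, abs_of_nonneg (div_nonneg hnn hn0.le), div_lt_iff₀ hn0]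
    have h3 := hcount n (C + η * ε / 4 * n) (by positivity) fun k hk => (hC k).trans (by gcongr)
    have h4 : 2 * (C + η * ε / 4 * n) / ε = 2 * C / ε + n * (η / 2) := by
      field_simp
      ring
    linarith
  have hconv := tendsto_integral_of_dominated_convergence (μ := P) (F := F) (f := fun _ => 0)
    (fun _ => 1) ?_ (integrable_const _) ?_ hlim
  · rw [integral_zero] at hconv
    have hconst : Tendsto (fun n => ∫ ω, F n ω ∂P) atTop (𝓝 (P.real (A 0))) :=
      tendsto_const_nhds.congr' ((eventually_ge_atTop 1).mono fun n hn => (hFint n hn).symm)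
    have h0 := tendsto_nhds_unique hconst hconv
    have h1 : P.real (A i) = 0 := (hPA i).trans h0
    exact (measureReal_eq_zero_iff).1 h1
  · intro n
    refine Measurable.aestronglyMeasurable ?_
    exact (Finset.measurable_fun_sum _ fun k _ => measurable_one.indicator (hAm k)).div_const _
  · intro n
    refine ae_of_all _ fun ω => ?_
    have hnn : 0 ≤ ∑ k ∈ Finset.range n, (A k).indicator (1 : Ω → ℝ) ω :=
      Finset.sum_nonneg fun k _ => indicator_nonneg (by simp) _
    have hle : ∑ k ∈ Finset.range n, (A k).indicator (1 : Ω → ℝ) ω ≤ n := by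
      calc ∑ k ∈ Finset.range n, (A k).indicator (1 : Ω → ℝ) ω
          ≤ ∑ k ∈ Finset.range n, (1 : ℝ) :=
            Finset.sum_le_sum fun k _ => by
              by_cases h : ω ∈ A k <;> simp [h]
        _ = n := by simp
    rw [Real.norm_eq_abs, abs_of_nonneg (div_nonneg hnn n.cast_nonneg)]
    exact div_le_one_of_le₀ hle n.cast_nonneg

/-- **Chung–Fuchs theorem**: a real random walk with centred steps is recurrent. -/
theorem ae_frequently_abs_sum_lt {D : ℕ → Ω → ℝ} (hmeas : ∀ k, Measurable (D k))
    (hind : iIndepFun D P) (hid : ∀ k, IdentDistrib (D k) (D 0) P P)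
    (hint : Integrable (D 0) P) (hmean : ∫ ω, D 0 ω ∂P = 0) :
    ∀ᵐ ω ∂P, ∀ ε > 0, ∃ᶠ n in atTop, |∑ k ∈ Finset.range n, D k ω| < ε := by
  have h : ∀ᵐ ω ∂P, ∀ m i : ℕ, ∃ n, 1 ≤ n ∧
      |∑ j ∈ Finset.range n, D (i + j) ω| < 1 / ((m : ℝ) + 1) := by
    rw [ae_all_iff]; intro m
    rw [ae_all_iff]; intro i
    have := measure_never_return_eq_zero hmeas hind hid hint hmean
      (ε := 1 / ((m : ℝ) + 1)) (by positivity) i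
    rw [ae_iff]
    convert this using 3
    push Not
    rfl
  filter_upwards [h] with ω hω ε hε
  refine frequently_abs_lt_of_returns (S := fun n => ∑ k ∈ Finset.range n, D k ω) (by simp) ?_ hε
  intro ε hε i
  obtain ⟨m, hm⟩ := exists_nat_one_div_lt hε
  obtain ⟨n, hn, hlt⟩ := hω m i
  refine ⟨n, hn, ?_⟩
  rw [Finset.sum_range_add, add_sub_cancel_left]
  exact hlt.trans hm

end RandomWalk

/-! ### Sums of independent variables: integrability and Ottaviani's inequality. -/

/-- If the sum of two independent random variables is integrable, the first one is. -/
theorem integrable_left_of_integrable_add {Ω : Type*} [MeasurableSpace Ω] {P : Measure Ω}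
    [IsProbabilityMeasure P] {U V : Ω → ℝ} (hU : Measurable U) (hV : Measurable V)
    (hind : IndepFun U V P) (hint : Integrable (fun ω => U ω + V ω) P) : Integrable U P := by
  have hUV : Integrable (fun z : ℝ × ℝ => z.1 + z.2) ((P.map U).prod (P.map V)) := by
    rw [← (indepFun_iff_map_prod_eq_prod_map_map hU.aemeasurable hV.aemeasurable).1 hind]
    exact (integrable_map_measure (by fun_prop) (by fun_prop)).2 hint
  have : IsProbabilityMeasure (P.map U) := Measure.isProbabilityMeasure_map hU.aemeasurable
  have : IsProbabilityMeasure (P.map V) := Measure.isProbabilityMeasure_map hV.aemeasurable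
  -- By Fubini some section `u ↦ u + v` is integrable for the law of `U`; subtracting the constant
  -- `v` finishes.
  obtain ⟨v, hv⟩ := hUV.prod_left_ae.exists
  have h1 : Integrable (fun u : ℝ => u) (P.map U) := by
    refine (hv.sub (integrable_const v)).congr (ae_of_all _ fun u => ?_)
    simp
  exact (integrable_map_measure (by fun_prop) hU.aemeasurable).1 h1

/-- **Ottaviani's inequality** for the partial sums of independent random variables. -/
theorem measure_exists_abs_sum_gt_le {Ω : Type*} [MeasurableSpace Ω] {P : Measure Ω}
    [IsProbabilityMeasure P] {ξ : ℕ → Ω → ℝ} (hmeas : ∀ k, Measurable (ξ k))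
    (hind : iIndepFun ξ P) (N : ℕ) (c : ℝ)
    (hc : ∀ j ≤ N, P {ω | c < |∑ k ∈ Finset.Ico j N, ξ k ω|} ≤ 1 / 2) :
    P {ω | ∃ j ≤ N, 2 * c < |∑ k ∈ Finset.range j, ξ k ω|}
      ≤ 2 * P {ω | c < |∑ k ∈ Finset.range N, ξ k ω|} := by
  set S : ℕ → Ω → ℝ := fun j ω => ∑ k ∈ Finset.range j, ξ k ω with hS
  -- `A j` says that `2 * c` is first exceeded at `j`, `B j` that the remaining sum is at most `c`.
  -- Together they force the full sum above `c`. They depend on disjoint sets of indices, hence are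
  -- independent, and `B j` has probability at least one half.
  set A : ℕ → Set Ω := fun j => {ω | (∀ i < j, |S i ω| ≤ 2 * c) ∧ 2 * c < |S j ω|} with hA
  set B : ℕ → Set Ω := fun j => {ω | |∑ k ∈ Finset.Ico j N, ξ k ω| ≤ c} with hB
  have hcover : {ω | ∃ j ≤ N, 2 * c < |S j ω|} ⊆ ⋃ j ∈ Finset.range (N + 1), A j := by
    classical
    rintro ω ⟨j, hj, hlt⟩
    have hex : ∃ j, 2 * c < |S j ω| := ⟨j, hlt⟩
    simp only [mem_iUnion, Finset.mem_range, exists_prop]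
    refine ⟨Nat.find hex, Nat.lt_succ_of_le ((Nat.find_min' hex hlt).trans hj),
      fun i hi => not_lt.1 (Nat.find_min hex hi), Nat.find_spec hex⟩
  have hsub : ⋃ j ∈ Finset.range (N + 1), A j ∩ B j ⊆ {ω | c < |S N ω|} := by
    intro ω hω
    simp only [mem_iUnion, Finset.mem_range, exists_prop] at hω
    obtain ⟨j, hj, ⟨-, h1⟩, h2⟩ := hω
    have e : S N ω = S j ω + ∑ k ∈ Finset.Ico j N, ξ k ω :=
      (Finset.sum_range_add_sum_Ico _ (Nat.lt_succ_iff.1 hj)).symm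
    have h3 := abs_sub_abs_le_abs_sub (S j ω) (-∑ k ∈ Finset.Ico j N, ξ k ω)
    rw [sub_neg_eq_add, ← e, abs_neg] at h3
    change |∑ k ∈ Finset.Ico j N, ξ k ω| ≤ c at h2
    change c < |S N ω|
    linarith
  have hsum : ∀ (s : Finset ℕ) (T : Set ℕ), (↑s ⊆ T) →
      Measurable[⨆ k ∈ T, MeasurableSpace.comap (ξ k) inferInstance]
        (fun ω => ∑ k ∈ s, ξ k ω) := by
    intro s T hsT
    refine Finset.measurable_fun_sum s fun k hk => ?_
    exact (comap_measurable (ξ k)).mono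
      (le_iSup₂ (f := fun k (_ : k ∈ T) => MeasurableSpace.comap (ξ k) inferInstance) k
        (hsT hk)) le_rfl
  have hle : ∀ k, MeasurableSpace.comap (ξ k) inferInstance ≤ ‹MeasurableSpace Ω› :=
    fun k => (hmeas k).comap_le
  have hleT : ∀ T : Set ℕ, ⨆ k ∈ T, MeasurableSpace.comap (ξ k) inferInstance
      ≤ ‹MeasurableSpace Ω› := fun T => iSup₂_le fun k _ => hle k
  have hAT : ∀ j, MeasurableSet[⨆ k ∈ Set.Iio j, MeasurableSpace.comap (ξ k) inferInstance]
      (A j) := by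
    intro j
    have hSm : ∀ i ≤ j, Measurable[⨆ k ∈ Set.Iio j, MeasurableSpace.comap (ξ k) inferInstance]
        (fun ω => |S i ω|) := fun i hi =>
      measurable_norm.comp (hsum (Finset.range i) (Set.Iio j) fun k hk => by
        simp only [Finset.coe_range, Set.mem_Iio] at hk ⊢
        omega)
    have e : A j = (⋂ i : ℕ, ⋂ _ : i < j, {ω | |S i ω| ≤ 2 * c}) ∩ {ω | 2 * c < |S j ω|} := by
      ext ω
      simp [hA]
    rw [e]
    refine MeasurableSet.inter (MeasurableSet.iInter fun i => MeasurableSet.iInter fun hi => ?_) ?_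
    · exact hSm i hi.le measurableSet_Iic
    · exact hSm j le_rfl measurableSet_Ioi
  have hBT : ∀ j, MeasurableSet[⨆ k ∈ Set.Ici j, MeasurableSpace.comap (ξ k) inferInstance]
      (B j) := fun j =>
    (measurable_norm.comp (hsum (Finset.Ico j N) (Set.Ici j) fun k hk => by
      simp only [Finset.coe_Ico, Set.mem_Ico, Set.mem_Ici] at hk ⊢
      omega)) measurableSet_Iic
  have hAm : ∀ j, MeasurableSet (A j) := fun j => hleT _ _ (hAT j)
  have hBm : ∀ j, MeasurableSet (B j) := fun j => hleT _ _ (hBT j)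
  have hAB : ∀ j, P (A j ∩ B j) = P (A j) * P (B j) := fun j => by
    have := indep_iSup_of_disjoint hle hind.iIndep (S := Set.Iio j) (T := Set.Ici j)
      (Set.disjoint_left.2 fun k (hk : k < j) (hk' : j ≤ k) => not_lt.2 hk' hk)
    exact (Indep_iff _ _ _).1 this _ _ (hAT j) (hBT j)
  have hhalf : ∀ j ∈ Finset.range (N + 1), P (A j) ≤ 2 * P (A j ∩ B j) := by
    intro j hj
    have h1 : P (B j)ᶜ ≤ 1 / 2 := by
      have : (B j)ᶜ = {ω | c < |∑ k ∈ Finset.Ico j N, ξ k ω|} := by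
        ext ω
        simp [hB]
      rw [this]
      exact hc j (Nat.lt_succ_iff.1 (Finset.mem_range.1 hj))
    have h2 : 1 / 2 ≤ P (B j) := by
      have h3 : (1 : ℝ≥0∞) = P (B j) + P (B j)ᶜ := (prob_add_prob_compl (hBm j)).symm
      have h4 : (1 : ℝ≥0∞) / 2 + 1 / 2 ≤ P (B j) + 1 / 2 := by
        rw [ENNReal.add_halves, h3]
        gcongr
        rw [← h3]
        exact h1
      exact (ENNReal.add_le_add_iff_right (by simp)).1 h4
    rw [hAB]
    calc P (A j) = P (A j) * (2 * (1 / 2)) := by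
          rw [one_div, ENNReal.mul_inv_cancel (by simp) (by simp), mul_one]
      _ ≤ P (A j) * (2 * P (B j)) := by gcongr
      _ = 2 * (P (A j) * P (B j)) := by ring
  have hdisj : (↑(Finset.range (N + 1)) : Set ℕ).PairwiseDisjoint fun j => A j ∩ B j := by
    have key : ∀ i j, i < j → Disjoint (A i) (A j) := fun i j hij =>
      Set.disjoint_left.2 fun ω hi hj => not_lt.2 (hj.1 i hij) hi.2
    intro i _ j _ hij
    refine Disjoint.mono inter_subset_left inter_subset_left ?_
    rcases lt_or_gt_of_ne hij with h | h
    · exact key i j h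
    · exact (key j i h).symm
  calc P {ω | ∃ j ≤ N, 2 * c < |S j ω|}
      ≤ P (⋃ j ∈ Finset.range (N + 1), A j) := measure_mono hcover
    _ ≤ ∑ j ∈ Finset.range (N + 1), P (A j) := measure_biUnion_finset_le _ _
    _ ≤ ∑ j ∈ Finset.range (N + 1), 2 * P (A j ∩ B j) := Finset.sum_le_sum hhalf
    _ = 2 * P (⋃ j ∈ Finset.range (N + 1), A j ∩ B j) := by
        rw [← Finset.mul_sum, measure_biUnion_finset hdisj fun j _ => (hAm j).inter (hBm j)]
    _ ≤ 2 * P {ω | c < |S N ω|} := by gcongr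

/-! ### Integrability and fluctuations of Lévy processes. -/

namespace IsLevyProcess

variable {Ω : Type*} [MeasurableSpace Ω] {P : Measure Ω} {L : ℝ≥0 → Ω → ℝ}

/-- The increments over intervals of the same length have the same law. -/
theorem identDistrib_sub (hL : IsLevyProcess L P) (s t h : ℝ≥0) :
    IdentDistrib (fun ω => L (s + h) ω - L s ω) (fun ω => L (t + h) ω - L t ω) P P :=
  (hL.stationary s h).trans (hL.stationary t h).symm

/-- The increment over an interval of length `t` has the law of the value at `t`. -/
theorem identDistrib_sub_self (hL : IsLevyProcess L P) (s t : ℝ≥0) :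
    IdentDistrib (fun ω => L (s + t) ω - L s ω) (L t) P P :=
  (hL.stationary s t).trans <| IdentDistrib.of_ae_eq
    ((hL.measurable t).sub (hL.measurable 0)).aemeasurable
    (by filter_upwards [hL.zero] with ω hω using by simp [hω])

theorem integral_sub_eq (hL : IsLevyProcess L P) (s t : ℝ≥0) :
    ∫ ω, (L (s + t) ω - L s ω) ∂P = ∫ ω, L t ω ∂P :=
  (hL.identDistrib_sub_self s t).integral_eq

theorem integrable_natCast (hL : IsLevyProcess L P) (h1 : Integrable (L 1) P) (n : ℕ) :
    Integrable (L n) P := by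
  induction n with
  | zero =>
    refine (integrable_zero Ω ℝ P).congr ?_
    filter_upwards [hL.zero] with ω hω using by simp [hω]
  | succ n ih =>
    have := ih.add ((hL.identDistrib_sub_self n 1).integrable_iff.2 h1)
    refine this.congr (ae_of_all _ fun ω => ?_)
    simp

variable [IsProbabilityMeasure P]

/-- A Lévy process that is integrable at time `1` is integrable at all times. -/
theorem integrable (hL : IsLevyProcess L P) (h1 : Integrable (L 1) P) (t : ℝ≥0) :
    Integrable (L t) P := by
  obtain ⟨n, hn⟩ := exists_nat_ge t
  -- For an integer `n ≥ t`, `L n` is the sum of the independent variables `L t` and `L n - L t`.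
  refine integrable_left_of_integrable_add (V := fun ω => L n ω - L t ω) (hL.measurable t)
    ((hL.measurable _).sub (hL.measurable _))
    (hL.indep.indepFun_eval_sub zero_le hn hL.zero) ?_
  simpa using hL.integrable_natCast h1 n

theorem integrable_sub (hL : IsLevyProcess L P) (h1 : Integrable (L 1) P) (s t : ℝ≥0) :
    Integrable (fun ω => L s ω - L t ω) P :=
  (hL.integrable h1 s).sub (hL.integrable h1 t)

theorem integral_add (hL : IsLevyProcess L P) (h1 : Integrable (L 1) P) (s t : ℝ≥0) :
    ∫ ω, L (s + t) ω ∂P = ∫ ω, L s ω ∂P + ∫ ω, L t ω ∂P := by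
  rw [← hL.integral_sub_eq s t, integral_sub (hL.integrable h1 _) (hL.integrable h1 _)]
  ring

/-- The values over a bounded time interval are uniformly tight. -/
theorem exists_forall_measure_abs_gt_le (hL : IsLevyProcess L P) (h1 : Integrable (L 1) P)
    (h : ℝ≥0) : ∃ c : ℝ, ∀ u ≤ h, P {ω | c < |L u ω|} ≤ 1 / 2 := by
  have hK : IsCompact (Icc 0 h) := isCompact_Icc
  suffices H : ∃ c : ℝ, ∀ u ∈ Icc 0 h, P {ω | c < |L u ω|} ≤ 1 / 2 by
    obtain ⟨c, hc⟩ := H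
    exact ⟨c, fun u hu => hc u ⟨zero_le, hu⟩⟩
  -- By compactness a local bound is enough. Near `x`, the tail of `L x` and stochastic continuity
  -- at `x` each contribute at most `1 / 4`.
  refine hK.induction_on (p := fun S => ∃ c : ℝ, ∀ u ∈ S, P {ω | c < |L u ω|} ≤ 1 / 2)
    ⟨0, by simp⟩ ?_ ?_ ?_
  · rintro S T hST ⟨c, hc⟩
    exact ⟨c, fun u hu => hc u (hST hu)⟩
  · rintro S T ⟨c, hc⟩ ⟨d, hd⟩
    refine ⟨max c d, fun u hu => ?_⟩
    rcases hu with hu | hu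
    · exact (measure_mono fun ω hω => (le_max_left c d).trans_lt hω).trans (hc u hu)
    · exact (measure_mono fun ω hω => (le_max_right c d).trans_lt hω).trans (hd u hu)
  · intro x _
    obtain ⟨c, hc⟩ : ∃ n : ℕ, P {ω | (n : ℝ) < |L x ω|} < 1 / 4 := by
      -- The tail-sum lemma speaks of `volume`. Summable tails tend to zero.
      let _ : MeasureSpace Ω := ⟨P⟩
      have : IsProbabilityMeasure (volume : Measure Ω) := ‹IsProbabilityMeasure P›
      have := tsum_prob_mem_Ioi_lt_top (X := fun ω => |L x ω|) (hL.integrable h1 x).abs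
        (fun ω => abs_nonneg _)
      exact ((ENNReal.tendsto_atTop_zero_of_tsum_ne_top this.ne).eventually_lt_const
        (by simp)).exists
    have h2 := (hL.stochCont x 1 (by simp)).eventually_lt_const
      (show (0 : ℝ≥0∞) < 1 / 4 by simp)
    refine ⟨_, mem_nhdsWithin_of_mem_nhds h2, c + 1, fun u hu => ?_⟩
    have hsub : {ω | (c : ℝ) + 1 < |L u ω|}
        ⊆ {ω | (c : ℝ) < |L x ω|} ∪ {ω | 1 ≤ edist (L u ω) (L x ω)} := by
      intro ω hω
      by_contra hcon
      simp only [mem_union, mem_ofPred_eq, not_or, not_lt, not_le] at hcon hω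
      obtain ⟨h3, h4⟩ := hcon
      rw [edist_dist, ← ENNReal.ofReal_one, ENNReal.ofReal_lt_ofReal_iff one_pos,
        Real.dist_eq] at h4
      have := abs_sub_abs_le_abs_sub (L u ω) (L x ω)
      linarith
    calc P {ω | (c : ℝ) + 1 < |L u ω|} ≤ _ := measure_mono hsub
      _ ≤ _ := measure_union_le _ _
      _ ≤ 1 / 4 + 1 / 4 := add_le_add hc.le hu.le
      _ = 1 / 2 := by
        rw [ENNReal.div_add_div_same, ENNReal.div_eq_div_iff] <;> norm_num

/-- **Ottaviani's inequality** for the finite time grid `a + j * δ`, `j ≤ N`. -/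
theorem measure_exists_grid_le (hL : IsLevyProcess L P) {h : ℝ≥0} {c : ℝ}
    (hc : ∀ u ≤ h, P {ω | c < |L u ω|} ≤ 1 / 2) (a δ : ℝ≥0) (N : ℕ) (hN : N * δ = h) :
    P {ω | ∃ j : ℕ, j ≤ N ∧ 2 * c < |L (a + j * δ) ω - L a ω|} ≤ 2 * P {ω | c < |L h ω|} := by
  have hmono : Monotone fun j : ℕ => a + j * δ := fun i j hij => by
    simp only
    gcongr
  have hset : ∀ s t : ℝ≥0, P {ω | c < |L (s + t) ω - L s ω|} = P {ω | c < |L t ω|} := fun s t =>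
    (hL.identDistrib_sub_self s t).measure_mem_eq (s := {x | c < |x|})
      (measurableSet_lt measurable_const (by fun_prop))
  have key := measure_exists_abs_sum_gt_le
    (fun k => (hL.measurable (a + (k + 1 : ℕ) * δ)).sub (hL.measurable (a + k * δ)))
    (hL.indep.nat hmono) N c ?_
  · simp only [Pi.sub_apply] at key
    have e : ∀ (j : ℕ) (ω : Ω), ∑ k ∈ Finset.range j,
        (L (a + (k + 1 : ℕ) * δ) ω - L (a + k * δ) ω) = L (a + j * δ) ω - L (a + (0 : ℕ) * δ) ω :=
      fun j ω => Finset.sum_range_sub (fun k : ℕ => L (a + k * δ) ω) j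
    simp only [e, Nat.cast_zero, zero_mul, add_zero, hN, hset a h] at key
    exact key
  · intro j hj
    simp only [Pi.sub_apply]
    have e' : ∀ ω : Ω, ∑ k ∈ Finset.Ico j N,
        (L (a + (k + 1 : ℕ) * δ) ω - L (a + k * δ) ω) = L (a + N * δ) ω - L (a + j * δ) ω :=
      fun ω => Finset.sum_Ico_sub (fun k : ℕ => L (a + k * δ) ω) hj
    simp only [e']
    have e : a + (N : ℝ≥0) * δ = (a + j * δ) + ((N - j : ℕ) : ℝ≥0) * δ := by
      rw [add_assoc, ← add_mul, ← Nat.cast_add, Nat.add_sub_cancel' hj]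
    rw [e, hset]
    refine hc _ ?_
    rw [← hN]
    gcongr
    omega

/-- **Ottaviani's inequality** for the increments over a time interval. -/
theorem measure_exists_interval_le (hL : IsLevyProcess L P) {h : ℝ≥0} (hh : 0 < h) {c : ℝ}
    (hc : ∀ u ≤ h, P {ω | c < |L u ω|} ≤ 1 / 2) (a : ℝ≥0) :
    P {ω | ∃ t, a ≤ t ∧ t ≤ a + h ∧ 2 * c < |L t ω - L a ω|} ≤ 2 * P {ω | c < |L h ω|} := by
  -- The dyadic grids are nested, so the bound for each grid passes to the increasing union.
  set E : ℕ → Set Ω := fun m =>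
    {ω | ∃ j : ℕ, j ≤ 2 ^ m ∧ 2 * c < |L (a + j * (h / 2 ^ m)) ω - L a ω|} with hE
  have hmono : Monotone E := by
    refine monotone_nat_of_le_succ fun m ω hω => ?_
    obtain ⟨j, hj, hlt⟩ := hω
    refine ⟨2 * j, by rw [pow_succ]; omega, ?_⟩
    have e : ((2 * j : ℕ) : ℝ≥0) * (h / 2 ^ (m + 1)) = j * (h / 2 ^ m) := by
      push_cast
      field_simp
      ring
    rw [e]
    exact hlt
  have hPE : P (⋃ m, E m) ≤ 2 * P {ω | c < |L h ω|} := by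
    rw [hmono.measure_iUnion]
    refine iSup_le fun m => hL.measure_exists_grid_le hc a (h / 2 ^ m) (2 ^ m) ?_
    push_cast
    field_simp
  refine (measure_mono_ae ?_).trans hPE
  filter_upwards [hL.cadlag] with ω hω hmem
  obtain ⟨t, hat, hth, hlt⟩ := hmem
  have hcont : ContinuousWithinAt (fun u => |L u ω - L a ω|) (Ici t) t :=
    ((hω.1 t).sub continuousWithinAt_const).abs
  have hev := hcont.eventually_const_lt hlt
  obtain ⟨δ, hδ, hball⟩ := Metric.mem_nhdsWithin_iff.1 hev
  obtain ⟨m, hm⟩ : ∃ m : ℕ, (h : ℝ) / 2 ^ m < δ := by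
    have : Tendsto (fun m : ℕ => (h : ℝ) * (1 / 2) ^ m) atTop (𝓝 ((h : ℝ) * 0)) :=
      (tendsto_pow_atTop_nhds_zero_of_lt_one (by norm_num) (by norm_num)).const_mul _
    rw [mul_zero] at this
    obtain ⟨m, hm⟩ := (this.eventually_lt_const hδ).exists
    refine ⟨m, ?_⟩
    simpa [div_eq_mul_inv] using hm
  refine mem_iUnion.2 ⟨m, ?_⟩
  have hd : 0 < h / 2 ^ m := by positivity
  -- Rounding up picks a grid point at or after `t`: right-continuity keeps the exceedance only on
  -- that side.
  set j := ⌈(t - a) / (h / 2 ^ m)⌉₊ with hj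
  have hj1 : t - a ≤ j * (h / 2 ^ m) := by
    rw [← div_le_iff₀ hd]
    exact Nat.le_ceil _
  have hj2 : (j : ℝ≥0) * (h / 2 ^ m) < t - a + h / 2 ^ m := by
    have := Nat.ceil_lt_add_one (a := (t - a) / (h / 2 ^ m)) zero_le
    rw [← hj] at this
    calc (j : ℝ≥0) * (h / 2 ^ m) < ((t - a) / (h / 2 ^ m) + 1) * (h / 2 ^ m) := by gcongr
      _ = t - a + h / 2 ^ m := by rw [add_mul, div_mul_cancel₀ _ hd.ne', one_mul]
  have hle : t ≤ a + j * (h / 2 ^ m) := by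
    rw [← tsub_le_iff_left]; exact hj1
  refine ⟨j, ?_, ?_⟩
  · refine Nat.ceil_le.2 ?_
    rw [div_le_iff₀ hd]
    push_cast
    rw [mul_div_cancel₀ _ (by positivity)]
    exact tsub_le_iff_left.2 hth
  · refine hball ⟨?_, hle⟩
    rw [Metric.mem_ball, NNReal.dist_eq, abs_of_nonneg (sub_nonneg.2 (by exact_mod_cast hle))]
    have h3 : a + (j : ℝ≥0) * (h / 2 ^ m) < t + h / 2 ^ m := by
      calc a + (j : ℝ≥0) * (h / 2 ^ m) < a + (t - a + h / 2 ^ m) := by gcongr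
        _ = t + h / 2 ^ m := by rw [← add_assoc, add_tsub_cancel_of_le hat]
    have h4 : ((a + (j : ℝ≥0) * (h / 2 ^ m) : ℝ≥0) : ℝ) < t + h / 2 ^ m := by exact_mod_cast h3
    linarith

/-- The fluctuations of an integrable Lévy process over intervals of a fixed length, along any
sequence of such intervals, grow at most sublinearly. -/
theorem ae_eventually_forall_abs_sub_le (hL : IsLevyProcess L P) (h1 : Integrable (L 1) P)
    {h : ℝ≥0} (hh : 0 < h) (a : ℕ → ℝ≥0) {ε : ℝ} (hε : 0 < ε) :
    ∀ᵐ ω ∂P, ∀ᶠ n : ℕ in atTop, ∀ t, a n ≤ t → t ≤ a n + h → |L t ω - L (a n) ω| ≤ ε * n := by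
  obtain ⟨c, hc⟩ := hL.exists_forall_measure_abs_gt_le h1 h
  -- Shifting the index by `N` makes the level `ε * (n + N) / 2` at least `c`, as Ottaviani's
  -- inequality requires.
  obtain ⟨N, hN⟩ := exists_nat_ge (2 * c / ε)
  have hcN : ∀ n : ℕ, c ≤ ε * (n + N : ℕ) / 2 := fun n => by
    rw [div_le_iff₀ hε] at hN
    push_cast
    have : 0 ≤ ε * n := by positivity
    linarith
  set F : ℕ → Set Ω := fun n => {ω | ∃ t, a (n + N) ≤ t ∧ t ≤ a (n + N) + h ∧
    2 * (ε * (n + N : ℕ) / 2) < |L t ω - L (a (n + N)) ω|} with hF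
  -- By stationarity the bound does not involve `a`; it is summable because `L h` is integrable.
  have hFle : ∀ n, P (F n) ≤ 2 * P {ω | |L h ω| * (2 / ε) ∈ Set.Ioi (n : ℝ)} := by
    intro n
    refine (hL.measure_exists_interval_le hh (fun u hu => ?_) _).trans ?_
    · exact (measure_mono fun ω hω => (hcN n).trans_lt hω).trans (hc u hu)
    · gcongr
      intro hlt
      rename_i ω
      simp only [Set.mem_Ioi]
      rw [mul_div_assoc', lt_div_iff₀ hε]
      have : ε * (n : ℝ) ≤ ε * (n + N : ℕ) := by
        gcongr
        omega
      linarith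
  have hsum : ∑' n, P (F n) ≠ ∞ := by
    let _ : MeasureSpace Ω := ⟨P⟩
    have : IsProbabilityMeasure (volume : Measure Ω) := ‹IsProbabilityMeasure P›
    have := tsum_prob_mem_Ioi_lt_top (X := fun ω => |L h ω| * (2 / ε))
      ((hL.integrable h1 h).abs.mul_const _) (fun ω => by positivity)
    refine ne_top_of_le_ne_top ?_ (ENNReal.tsum_le_tsum hFle)
    rw [ENNReal.tsum_mul_left]
    exact ENNReal.mul_ne_top (by simp) this.ne
  filter_upwards [ae_eventually_notMem hsum] with ω hω
  obtain ⟨K, hK⟩ := eventually_atTop.1 hω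
  refine eventually_atTop.2 ⟨K + N, fun n hn t hat hth => ?_⟩
  have := hK (n - N) (by omega)
  simp only [hF, show n - N + N = n by omega] at this
  by_contra hlt
  push Not at hlt
  exact this ⟨t, hat, hth, by linarith⟩

end IsLevyProcess

/-! ### Independence of regrouped families. -/

section Independence

variable {Ω : Type*} [MeasurableSpace Ω] {P : Measure Ω} [IsProbabilityMeasure P]

/-- Two independent random variables form an independent family indexed by `Bool`. -/
theorem iIndepFun_bool {E : Type*} [MeasurableSpace E] {f : Bool → Ω → E}
    (hf : ∀ b, Measurable (f b)) (h : IndepFun (f true) (f false) P) : iIndepFun f P := by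
  have hprob : ∀ b, IsProbabilityMeasure (P.map (f b)) := fun b =>
    Measure.isProbabilityMeasure_map (hf b).aemeasurable
  rw [iIndepFun_iff_map_fun_eq_pi_map fun b => (hf b).aemeasurable]
  refine (Measure.pi_eq fun s hs => ?_).symm
  rw [Measure.map_apply (by fun_prop) (MeasurableSet.univ_pi hs), Fintype.prod_bool,
    Measure.map_apply (hf _) (hs _), Measure.map_apply (hf _) (hs _),
    ← h.measure_inter_preimage_eq_mul _ _ (hs _) (hs _)]
  congr 1
  ext ω
  simp [and_comm]

/-- The rows of an independent double-indexed family are independent. -/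
theorem iIndepFun_curry {ι κ E : Type*} [MeasurableSpace E] {f : ι → κ → Ω → E}
    (hf : ∀ i j, Measurable (f i j)) (h : iIndepFun (fun (a : ι × κ) => f a.1 a.2) P) :
    iIndepFun (fun i ω j => f i j ω) P := by
  have hprob : ∀ i j, IsProbabilityMeasure (P.map (f i j)) := fun i j =>
    Measure.isProbabilityMeasure_map (hf i j).aemeasurable
  rw [iIndepFun_iff_map_fun_eq_infinitePi_map (by fun_prop)]
  have hrow : ∀ i, P.map (fun ω j => f i j ω) = Measure.infinitePi fun j => P.map (f i j) :=
    fun i => (h.precomp (g := fun j => (i, j)) (Prod.mk_right_injective i)).map_fun_eq_infinitePi_map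
      (hf i)
  have hall := h.map_fun_eq_infinitePi_map fun a : ι × κ => hf a.1 a.2
  simp only [hrow]
  rw [← Measure.infinitePi_map_curry (fun i j => P.map (f i j)), ← hall,
    Measure.map_map (by fun_prop) (by fun_prop)]
  rfl

end Independence

/-! ### Block increments over a period. -/

/-- The increment over the `k`-th period of length `α + γ + δ` after time `s` of a process that
follows `L`, then `M`, then `L` for durations `α`, `γ`, `δ`. -/
def blockIncrement {Ω : Type*} (L M : ℝ≥0 → Ω → ℝ) (s α γ δ : ℝ≥0) (k : ℕ) (ω : Ω) : ℝ :=
  (L (s + k * (α + γ + δ) + α) ω - L (s + k * (α + γ + δ)) ω)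
    + (M (s + k * (α + γ + δ) + α + γ) ω - M (s + k * (α + γ + δ) + α) ω)
    + (L (s + k * (α + γ + δ) + α + γ + δ) ω - L (s + k * (α + γ + δ) + α + γ) ω)

section Block

variable {Ω : Type*} [MeasurableSpace Ω] {P : Measure Ω} {L M : ℝ≥0 → Ω → ℝ}

theorem measurable_blockIncrement (hL : IsLevyProcess L P) (hM : IsLevyProcess M P)
    (s α γ δ : ℝ≥0) (k : ℕ) : Measurable (blockIncrement L M s α γ δ k) :=
  ((((hL.measurable _).sub (hL.measurable _)).add ((hM.measurable _).sub (hM.measurable _))).add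
    ((hL.measurable _).sub (hL.measurable _)))

/-- The times that cut each period after time `s` into pieces of lengths `d 0`, `d 1`, `d 2`. -/
def periodicGrid (s : ℝ≥0) (d : Fin 3 → ℝ≥0) (j : ℕ) : ℝ≥0 :=
  s + ∑ i ∈ Finset.range j, d (Fin.ofNat 3 i)

theorem periodicGrid_succ (s : ℝ≥0) (d : Fin 3 → ℝ≥0) (j : ℕ) :
    periodicGrid s d (j + 1) = periodicGrid s d j + d (Fin.ofNat 3 j) := by
  simp only [periodicGrid, Finset.sum_range_succ, add_assoc]

theorem monotone_periodicGrid (s : ℝ≥0) (d : Fin 3 → ℝ≥0) : Monotone (periodicGrid s d) :=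
  monotone_nat_of_le_succ fun j => by rw [periodicGrid_succ]; exact le_self_add

theorem periodicGrid_succ_mul_add (s : ℝ≥0) (d : Fin 3 → ℝ≥0) (k : ℕ) (i : Fin 3) :
    periodicGrid s d (3 * k + i + 1) = periodicGrid s d (3 * k + i) + d i := by
  rw [periodicGrid_succ]
  congr 2
  ext
  simp only [Fin.ofNat]
  omega

theorem periodicGrid_three_mul (s : ℝ≥0) (d : Fin 3 → ℝ≥0) (k : ℕ) :
    periodicGrid s d (3 * k) = s + k * (d 0 + d 1 + d 2) := by
  induction k with
  | zero => simp [periodicGrid]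
  | succ k ih =>
    have h0 := periodicGrid_succ_mul_add s d k 0
    have h1 := periodicGrid_succ_mul_add s d k 1
    have h2 := periodicGrid_succ_mul_add s d k 2
    simp only [Fin.val_zero, Fin.val_one, Fin.val_two, add_zero, Nat.add_assoc,
      Nat.reduceAdd] at h0 h1 h2
    rw [show 3 * (k + 1) = 3 * k + 3 by ring, h2, h1, h0, ih]
    push_cast
    ring

/-- With all cut times on one monotone sequence, the independence of increments along a sequence
serves every block at once. -/
theorem blockIncrement_eq_periodicGrid {Ω : Type*} (L M : ℝ≥0 → Ω → ℝ) (s α γ δ : ℝ≥0) (k : ℕ) (ω : Ω) :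
    blockIncrement L M s α γ δ k ω =
      (L (periodicGrid s ![α, γ, δ] (3 * k + 1)) ω - L (periodicGrid s ![α, γ, δ] (3 * k)) ω)
      + (M (periodicGrid s ![α, γ, δ] (3 * k + 2)) ω
        - M (periodicGrid s ![α, γ, δ] (3 * k + 1)) ω)
      + (L (periodicGrid s ![α, γ, δ] (3 * k + 3)) ω
        - L (periodicGrid s ![α, γ, δ] (3 * k + 2)) ω) := by
  have h := periodicGrid_three_mul s ![α, γ, δ] k
  have h0 := periodicGrid_succ_mul_add s ![α, γ, δ] k 0
  have h1 := periodicGrid_succ_mul_add s ![α, γ, δ] k 1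
  have h2 := periodicGrid_succ_mul_add s ![α, γ, δ] k 2
  simp only [Fin.val_zero, Fin.val_one, Fin.val_two, add_zero, Nat.add_assoc,
    Nat.reduceAdd, Matrix.cons_val] at h h0 h1 h2
  rw [h2, h1, h0, h]
  rfl

variable [IsProbabilityMeasure P]

/-- The block increments of two independent Lévy processes are i.i.d. -/
theorem iIndepFun_identDistrib_blockIncrement (hL : IsLevyProcess L P) (hM : IsLevyProcess M P)
    (hLM : IndepFun (fun ω t => L t ω) (fun ω t => M t ω) P) (s α γ δ : ℝ≥0) :
    iIndepFun (blockIncrement L M s α γ δ) P ∧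
      ∀ k, IdentDistrib (blockIncrement L M s α γ δ k) (blockIncrement L M s α γ δ 0) P P := by
  set d : Fin 3 → ℝ≥0 := ![α, γ, δ] with hd
  set τ : ℕ → ℝ≥0 := periodicGrid s d with hτ
  set U : Bool → ℝ≥0 → Ω → ℝ := fun b => cond b L M with hU
  have hUL : ∀ b, IsLevyProcess (U b) P := by
    intro b
    cases b
    · exact hM
    · exact hL
  set I : Bool → ℕ → Ω → ℝ := fun b j ω => U b (τ (j + 1)) ω - U b (τ j) ω with hI
  have hIm : ∀ b j, Measurable (I b j) := fun b j =>
    ((hUL b).measurable _).sub ((hUL b).measurable _)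
  have hIindep : iIndepFun (fun a : Bool × ℕ => I a.1 a.2) P := by
    refine iIndepFun_uncurry' hIm (iIndepFun_bool (fun b => by fun_prop) ?_)
      fun b => (hUL b).indep.nat (monotone_periodicGrid s d)
    exact hLM.comp (φ := fun x j => x (τ (j + 1)) - x (τ j))
      (ψ := fun x j => x (τ (j + 1)) - x (τ j)) (by fun_prop) (by fun_prop)
  -- Grid index `3 * k + i` is piece `i` of block `k`; this regroups the increments by block.
  have hinj : Function.Injective
      fun a : ℕ × (Bool × Fin 3) => (a.2.1, 3 * a.1 + (a.2.2 : ℕ)) := by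
    rintro ⟨k, b, i⟩ ⟨k', b', i'⟩ h
    simp only [Prod.mk.injEq] at h ⊢
    refine ⟨by omega, h.1, ?_⟩
    ext
    omega
  have hJindep : iIndepFun (fun a : ℕ × (Bool × Fin 3) => I a.2.1 (3 * a.1 + (a.2.2 : ℕ))) P :=
    hIindep.precomp hinj
  -- Of the six increments over a period, a block uses those of `L` (`true`) on pieces 0 and 2 and
  -- that of `M` (`false`) on piece 1.
  set v : (Bool × Fin 3 → ℝ) → ℝ := fun x => x (true, 0) + x (false, 1) + x (true, 2) with hv
  have hvm : Measurable v := by fun_prop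
  have hblock : ∀ k, blockIncrement L M s α γ δ k
      = v ∘ fun ω (c : Bool × Fin 3) => I c.1 (3 * k + (c.2 : ℕ)) ω := fun k => by
    funext ω
    rw [blockIncrement_eq_periodicGrid]
    rfl
  constructor
  · have := (iIndepFun_curry (f := fun (k : ℕ) (c : Bool × Fin 3) => I c.1 (3 * k + (c.2 : ℕ)))
      (fun k c => hIm _ _) hJindep).comp (fun _ => v) fun _ => hvm
    rw [show blockIncrement L M s α γ δ = _ from funext hblock]
    exact this
  · intro k
    rw [hblock k, hblock 0]
    have hrow : ∀ k, iIndepFun (fun c : Bool × Fin 3 => I c.1 (3 * k + (c.2 : ℕ))) P := fun k =>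
      hJindep.precomp (g := fun c => (k, c)) (Prod.mk_right_injective k)
    refine (IdentDistrib.pi (fun c => ?_) (hrow k) (hrow 0)).comp hvm
    have e : ∀ k, I c.1 (3 * k + (c.2 : ℕ)) = fun ω =>
        U c.1 (τ (3 * k + (c.2 : ℕ)) + d c.2) ω - U c.1 (τ (3 * k + (c.2 : ℕ))) ω := fun k => by
      simp only [hI, hτ, periodicGrid_succ_mul_add]
    rw [e k, e 0]
    exact (hUL c.1).identDistrib_sub _ _ _

theorem integrable_blockIncrement (hL : IsLevyProcess L P) (hM : IsLevyProcess M P)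
    (hL1 : Integrable (L 1) P) (hM1 : Integrable (M 1) P) (s α γ δ : ℝ≥0) (k : ℕ) :
    Integrable (blockIncrement L M s α γ δ k) P :=
  ((hL.integrable_sub hL1 _ _).add (hM.integrable_sub hM1 _ _)).add (hL.integrable_sub hL1 _ _)

/-- The mean depends on `α` and `δ` only through their sum, since `t ↦ ∫ L t` is additive; this
removes the dependence on the phase. -/
theorem integral_blockIncrement (hL : IsLevyProcess L P) (hM : IsLevyProcess M P)
    (hL1 : Integrable (L 1) P) (hM1 : Integrable (M 1) P) (s α γ δ : ℝ≥0) (k : ℕ) :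
    ∫ ω, blockIncrement L M s α γ δ k ω ∂P = ∫ ω, L (α + δ) ω ∂P + ∫ ω, M γ ω ∂P := by
  simp only [blockIncrement]
  rw [MeasureTheory.integral_add
      (by exact (hL.integrable_sub hL1 _ _).add (hM.integrable_sub hM1 _ _))
      (hL.integrable_sub hL1 _ _),
    MeasureTheory.integral_add (hL.integrable_sub hL1 _ _) (hM.integrable_sub hM1 _ _),
    hL.integral_sub_eq, hM.integral_sub_eq, hL.integral_sub_eq, hL.integral_add hL1]
  ring

end Block

/-! ### The alternating process: skeleton walk, recurrence and its converse. -/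

namespace IsAlternatingProcess

variable {Ω : Type*} [MeasurableSpace Ω] {P : Measure Ω} {p q : ℝ≥0} {X Y Z : ℝ≥0 → Ω → ℝ}

/-- The left endpoint, excluded in `onY`, is admitted here, so increments over adjacent stretches
can be added up. -/
theorem sub_eq_of_onY (hX : IsAlternatingProcess p q Y Z X P) (n : ℕ) {t u : ℝ≥0}
    (ht : n * p ≤ t) (htu : t ≤ u) (hu : u ≤ n * p + q) (ω : Ω) :
    X u ω - X t ω = Y u ω - Y t ω := by
  have key : ∀ w, n * p ≤ w → w ≤ n * p + q →
      X w ω = X (n * p) ω + Y w ω - Y (n * p) ω := fun w h1 h2 => by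
    rcases h1.eq_or_lt with rfl | h1
    · ring
    · exact hX.onY n w h1 h2 ω
  rw [key t ht (htu.trans hu), key u (ht.trans htu) hu]
  ring

theorem sub_eq_of_onZ (hX : IsAlternatingProcess p q Y Z X P) (n : ℕ) {t u : ℝ≥0}
    (ht : n * p + q ≤ t) (htu : t ≤ u) (hu : u ≤ (n + 1) * p) (ω : Ω) :
    X u ω - X t ω = Z u ω - Z t ω := by
  have key : ∀ w, n * p + q ≤ w → w ≤ (n + 1) * p →
      X w ω = X (n * p + q) ω + Z w ω - Z (n * p + q) ω := fun w h1 h2 => by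
    rcases h1.eq_or_lt with rfl | h1
    · ring
    · exact hX.onZ n w h1 h2 ω
  rw [key t ht (htu.trans hu), key u (ht.trans htu) hu]
  ring

/-- When `s` lies in a period where `X` follows `Y`, the increments of `X` along `s + k * p` are
block increments. -/
theorem sub_eq_blockIncrement_of_onY {α γ δ : ℝ≥0}
    (hX : IsAlternatingProcess (δ + α + γ) (δ + α) Y Z X P) (n k : ℕ) (ω : Ω) :
    X (n * (δ + α + γ) + δ + (k + 1 : ℕ) * (δ + α + γ)) ω
        - X (n * (δ + α + γ) + δ + k * (δ + α + γ)) ω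
      = blockIncrement Y Z (n * (δ + α + γ) + δ) α γ δ k ω := by
  -- `δ` is the phase inside a `Y`-stretch: `α` is the rest of that stretch, `γ` the whole
  -- `Z`-stretch, and the last `δ` opens the next `Y`-stretch.
  have e : α + γ + δ = δ + α + γ := by ring
  set p := δ + α + γ with hp
  set t := (n : ℝ≥0) * p + δ + k * p with ht
  have et : t = (n + k : ℕ) * p + δ := by rw [ht]; push_cast; ring
  have h1 := hX.sub_eq_of_onY (n + k) (t := t) (u := t + α) (by rw [et]; exact le_self_add)
    le_self_add (by rw [et, add_assoc]) ω
  have h2 := hX.sub_eq_of_onZ (n + k) (t := t + α) (u := t + α + γ) (by rw [et, add_assoc])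
    le_self_add (by rw [et, hp]; apply le_of_eq; ring) ω
  have h3 := hX.sub_eq_of_onY (n + k + 1) (t := t + α + γ) (u := t + α + γ + δ)
    (by rw [et, hp]; apply le_of_eq; push_cast; ring) le_self_add
    (by
      rw [et, show ((n + k : ℕ) : ℝ≥0) * p + δ + α + γ + δ = (n + k + 1 : ℕ) * p + δ by
        rw [hp]; push_cast; ring]
      gcongr
      exact le_self_add) ω
  have elast : (n : ℝ≥0) * p + δ + (k + 1 : ℕ) * p = t + α + γ + δ := by
    rw [ht, hp]; push_cast; ring
  rw [elast, blockIncrement, e, ← ht, ← h1, ← h2, ← h3]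
  ring

/-- When `s` lies in a period where `X` follows `Z`, the increments of `X` along `s + k * p` are
block increments. -/
theorem sub_eq_blockIncrement_of_onZ {α γ δ : ℝ≥0}
    (hX : IsAlternatingProcess (γ + δ + α) γ Y Z X P) (n k : ℕ) (ω : Ω) :
    X (n * (γ + δ + α) + (γ + δ) + (k + 1 : ℕ) * (γ + δ + α)) ω
        - X (n * (γ + δ + α) + (γ + δ) + k * (γ + δ + α)) ω
      = blockIncrement Z Y (n * (γ + δ + α) + (γ + δ)) α γ δ k ω := by
  -- Here `δ` is the time already spent in the `Z`-stretch, `α` the rest of it, and `γ` the whole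
  -- next `Y`-stretch.
  have e : α + γ + δ = γ + δ + α := by ring
  set p := γ + δ + α with hp
  set t := (n : ℝ≥0) * p + (γ + δ) + k * p with ht
  have et : t = (n + k : ℕ) * p + γ + δ := by rw [ht]; push_cast; ring
  have h1 := hX.sub_eq_of_onZ (n + k) (t := t) (u := t + α) (by rw [et]; exact le_self_add)
    le_self_add (by rw [et, hp]; apply le_of_eq; ring) ω
  have h2 := hX.sub_eq_of_onY (n + k + 1) (t := t + α) (u := t + α + γ)
    (by rw [et, hp]; apply le_of_eq; push_cast; ring)
    le_self_add (by rw [et, hp]; apply le_of_eq; push_cast; ring) ω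
  have h3 := hX.sub_eq_of_onZ (n + k + 1) (t := t + α + γ) (u := t + α + γ + δ)
    (by rw [et, hp]; apply le_of_eq; push_cast; ring) le_self_add
    (by
      rw [et, show ((n + k : ℕ) : ℝ≥0) * p + γ + δ + α + γ + δ = (n + k + 1 : ℕ) * p + γ + δ by
        rw [hp]; push_cast; ring, add_assoc, add_mul _ 1, one_mul]
      gcongr
      exact le_self_add) ω
  have elast : (n : ℝ≥0) * p + (γ + δ) + (k + 1 : ℕ) * p = t + α + γ + δ := by
    rw [ht, hp]; push_cast; ring
  rw [elast, blockIncrement, e, ← ht, ← h1, ← h2, ← h3]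
  ring

/-- Every time is the sum of a multiple of the period and a phase. -/
theorem exists_eq_mul_add (hp : 0 < p) (s : ℝ≥0) : ∃ (n : ℕ) (r : ℝ≥0), r < p ∧ s = n * p + r := by
  have h1 : (⌊s / p⌋₊ : ℝ≥0) * p ≤ s := by
    rw [← le_div_iff₀ hp]
    exact Nat.floor_le zero_le
  obtain ⟨r, hr⟩ := exists_add_of_le h1
  refine ⟨⌊s / p⌋₊, r, ?_, hr⟩
  have h2 : s < (⌊s / p⌋₊ + 1) * p := by
    rw [← div_lt_iff₀ hp]
    exact Nat.lt_floor_add_one _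
  rw [add_mul, one_mul] at h2
  exact lt_of_add_lt_add_left (hr.symm.trans_lt h2)

variable [IsProbabilityMeasure P]

/-- The increments of the alternating process along `s + k * p` are i.i.d. with the mean of
`Y q + Z (p - q)`. -/
theorem increments_iid (hX : IsAlternatingProcess p q Y Z X P) (hq : 0 < q) (hqp : q < p)
    (hY : IsLevyProcess Y P) (hZ : IsLevyProcess Z P)
    (hYZ : IndepFun (fun ω t => Y t ω) (fun ω t => Z t ω) P)
    (hY1 : Integrable (Y 1) P) (hZ1 : Integrable (Z 1) P) (s : ℝ≥0) :
    ∃ D : ℕ → Ω → ℝ, (∀ k ω, X (s + (k + 1 : ℕ) * p) ω - X (s + k * p) ω = D k ω) ∧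
      (∀ k, Measurable (D k)) ∧ iIndepFun D P ∧ (∀ k, IdentDistrib (D k) (D 0) P P) ∧
      Integrable (D 0) P ∧ ∫ ω, D 0 ω ∂P = ∫ ω, (Y q ω + Z (p - q) ω) ∂P := by
  have hmean : ∫ ω, (Y q ω + Z (p - q) ω) ∂P = ∫ ω, Y q ω ∂P + ∫ ω, Z (p - q) ω ∂P :=
    MeasureTheory.integral_add (hY.integrable hY1 q) (hZ.integrable hZ1 _)
  obtain ⟨n, r, hr, rfl⟩ := exists_eq_mul_add (hq.trans hqp) s
  rw [hmean]
  rcases le_or_gt r q with hrq | hrq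
  · obtain ⟨α, rfl⟩ := exists_add_of_le hrq
    obtain ⟨γ, rfl⟩ := exists_add_of_le hqp.le
    obtain ⟨h1, h2⟩ := iIndepFun_identDistrib_blockIncrement hY hZ hYZ
      (n * (r + α + γ) + r) α γ r
    refine ⟨_, hX.sub_eq_blockIncrement_of_onY n,
      measurable_blockIncrement hY hZ _ α γ r, h1, h2,
      integrable_blockIncrement hY hZ hY1 hZ1 _ _ _ _ _, ?_⟩
    rw [integral_blockIncrement hY hZ hY1 hZ1, add_tsub_cancel_left, add_comm α r]
  · obtain ⟨δ, rfl⟩ := exists_add_of_le hrq.le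
    obtain ⟨α, rfl⟩ := exists_add_of_le hr.le
    obtain ⟨h1, h2⟩ := iIndepFun_identDistrib_blockIncrement hZ hY hYZ.symm
      (n * (q + δ + α) + (q + δ)) α q δ
    refine ⟨_, hX.sub_eq_blockIncrement_of_onZ n,
      measurable_blockIncrement hZ hY _ α q δ, h1, h2,
      integrable_blockIncrement hZ hY hZ1 hY1 _ _ _ _ _, ?_⟩
    rw [integral_blockIncrement hZ hY hZ1 hY1, add_assoc q, add_tsub_cancel_left, add_comm α δ,
      add_comm]

/-- If the mean increment over a period vanishes, the alternating process is recurrent. -/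
theorem isRecurrentProcess (hX : IsAlternatingProcess p q Y Z X P) (hq : 0 < q) (hqp : q < p)
    (hY : IsLevyProcess Y P) (hZ : IsLevyProcess Z P)
    (hYZ : IndepFun (fun ω t => Y t ω) (fun ω t => Z t ω) P)
    (hY1 : Integrable (Y 1) P) (hZ1 : Integrable (Z 1) P)
    (hmean : ∫ ω, (Y q ω + Z (p - q) ω) ∂P = 0) : IsRecurrentProcess X P := by
  intro s
  obtain ⟨D, hD, hDm, hind, hid, hint, hDmean⟩ :=
    hX.increments_iid hq hqp hY hZ hYZ hY1 hZ1 s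
  filter_upwards [ae_frequently_abs_sum_lt hDm hind hid hint (hDmean.trans hmean)] with ω hω
  have hsum : ∀ n : ℕ, ∑ k ∈ Finset.range n, D k ω = X (s + n * p) ω - X s ω := fun n => by
    simp only [← hD]
    rw [Finset.sum_range_sub (fun k : ℕ => X (s + k * p) ω)]
    simp
  have htend : Tendsto (fun n : ℕ => s + n * p) atTop atTop :=
    tendsto_atTop_mono (fun n => le_add_self)
      (tendsto_natCast_atTop_atTop.atTop_mul_const (hq.trans hqp))
  refine le_antisymm (ENNReal.le_of_forall_pos_le_add fun ε hε _ => ?_) zero_le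
  rw [zero_add]
  refine liminf_le_of_frequently_le' (htend.frequently ?_)
  refine (hω ε (by exact_mod_cast hε)).mono fun n hn => ?_
  rw [hsum] at hn
  rw [← ofReal_norm, Real.norm_eq_abs, ← ENNReal.ofReal_coe_nnreal]
  exact ENNReal.ofReal_le_ofReal hn.le

/-- Almost surely, the fluctuations of the alternating process within the `n`-th period
are `o(n)`. -/
theorem ae_eventually_forall_abs_sub_le (hX : IsAlternatingProcess p q Y Z X P) (hq : 0 < q)
    (hqp : q < p) (hY : IsLevyProcess Y P) (hZ : IsLevyProcess Z P)
    (hY1 : Integrable (Y 1) P) (hZ1 : Integrable (Z 1) P) {ε : ℝ} (hε : 0 < ε) :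
    ∀ᵐ ω ∂P, ∀ᶠ n : ℕ in atTop, ∀ t, n * p ≤ t → t ≤ (n + 1) * p →
      |X t ω - X (n * p) ω| ≤ ε * n := by
  filter_upwards [hY.ae_eventually_forall_abs_sub_le hY1 hq (fun n => n * p) (half_pos hε),
    hZ.ae_eventually_forall_abs_sub_le hZ1 (tsub_pos_of_lt hqp) (fun n => n * p + q)
      (half_pos hε)] with ω h1 h2
  filter_upwards [h1, h2] with n h1 h2 t ht1 ht2
  have hn : 0 ≤ ε / 2 * n := by positivity
  rcases le_total t (n * p + q) with h | h
  · have := h1 t ht1 h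
    rw [← hX.sub_eq_of_onY n le_rfl ht1 h] at this
    linarith
  -- In the `Z`-stretch the path is compared with its value at `n * p + q`; each leg costs `ε / 2 *
  -- n`.
  · have h3 := h1 _ le_self_add le_rfl
    rw [← hX.sub_eq_of_onY n le_rfl le_self_add le_rfl] at h3
    have h4 := h2 t h (ht2.trans (by
      rw [add_assoc, add_tsub_cancel_of_le hqp.le, add_mul, one_mul]))
    rw [← hX.sub_eq_of_onZ n le_rfl h ht2] at h4
    have := abs_add_le (X t ω - X (n * p + q) ω) (X (n * p + q) ω - X (n * p) ω)
    rw [sub_add_sub_cancel] at this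
    linarith

/-- If the alternating process is recurrent, the mean increment over a period vanishes. -/
theorem integral_eq_zero_of_isRecurrentProcess (hX : IsAlternatingProcess p q Y Z X P)
    (hq : 0 < q) (hqp : q < p) (hY : IsLevyProcess Y P) (hZ : IsLevyProcess Z P)
    (hYZ : IndepFun (fun ω t => Y t ω) (fun ω t => Z t ω) P)
    (hY1 : Integrable (Y 1) P) (hZ1 : Integrable (Z 1) P) (hrec : IsRecurrentProcess X P) :
    ∫ ω, (Y q ω + Z (p - q) ω) ∂P = 0 := by
  have hp := hq.trans hqp
  by_contra hm
  set m := ∫ ω, (Y q ω + Z (p - q) ω) ∂P with hmdef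
  have hm0 : 0 < |m| := abs_pos.2 hm
  obtain ⟨D, hD, hDm, hind, hid, hint, hDmean⟩ :=
    hX.increments_iid hq hqp hY hZ hYZ hY1 hZ1 0
  have hslln := strong_law_ae_real D hint (fun a b hab => hind.indepFun hab) hid
  rw [hDmean] at hslln
  obtain ⟨ω, hω1, hω2, hω3⟩ := (hslln.and ((hX.ae_eventually_forall_abs_sub_le hq hqp hY hZ hY1 hZ1
    (ε := |m| / 4) (by positivity)).and (hrec 0))).exists
  have hsum : ∀ n : ℕ, ∑ k ∈ Finset.range n, D k ω = X (n * p) ω - X 0 ω := fun n => by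
    simp only [← hD]
    rw [Finset.sum_range_sub (fun k : ℕ => X (0 + k * p) ω)]
    simp
  have hlow : ∀ᶠ n : ℕ in atTop, |m| / 2 * n ≤ |X (n * p) ω - X 0 ω| := by
    have := hω1.abs.eventually_const_lt (show |m| / 2 < |m| by linarith)
    filter_upwards [this, eventually_gt_atTop 0] with n hn hn0
    have hn0' : (0 : ℝ) < n := by exact_mod_cast hn0
    rw [hsum, abs_div, abs_of_pos hn0', lt_div_iff₀ hn0'] at hn
    exact hn.le
  have hbig : ∀ᶠ n : ℕ in atTop, 1 ≤ |m| / 4 * n :=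
    (tendsto_natCast_atTop_atTop.const_mul_atTop (by positivity)).eventually_ge_atTop 1
  obtain ⟨N, hN⟩ := ((hlow.and hω2).and hbig).exists_forall_of_atTop
  -- The skeleton is at distance at least `|m| / 2 * n` and the period moves it by at most `|m| / 4
  -- * n`, which leaves at least `|m| / 4 * n ≥ 1`.
  have hfar : ∀ᶠ t : ℝ≥0 in atTop, (1 : ℝ≥0∞) ≤ ‖X t ω - X 0 ω‖ₑ := by
    filter_upwards [eventually_ge_atTop (N * p)] with t ht
    obtain ⟨n, r, hr, rfl⟩ := exists_eq_mul_add hp t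
    have hNn : N ≤ n := by
      have h1 : (N : ℝ≥0) * p < (n + 1) * p := by
        rw [add_mul, one_mul]
        exact ht.trans_lt (by gcongr)
      have h2 : (N : ℝ≥0) < n + 1 := lt_of_mul_lt_mul_right h1 zero_le
      exact Nat.lt_succ_iff.1 (by exact_mod_cast h2)
    obtain ⟨⟨h1, h2⟩, h3⟩ := hN n hNn
    have h4 := h2 (n * p + r) le_self_add (by rw [add_mul, one_mul]; gcongr)
    have h5 := abs_add_le (X (n * p) ω - X (n * p + r) ω) (X (n * p + r) ω - X 0 ω)
    rw [sub_add_sub_cancel, abs_sub_comm (X (n * p) ω) (X (n * p + r) ω)] at h5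
    rw [← ofReal_norm, Real.norm_eq_abs, ← ENNReal.ofReal_one]
    exact ENNReal.ofReal_le_ofReal (by linarith)
  have := le_liminf_of_le (by isBoundedDefault) hfar
  rw [hω3] at this
  exact absurd this (by simp)

end IsAlternatingProcess

theorem proposition4p2 {Ω : Type*} [MeasurableSpace Ω] (P : Measure Ω) [IsProbabilityMeasure P]
    (p q : ℝ≥0) (hq : 0 < q) (hqp : q < p) (X Y Z : ℝ≥0 → Ω → ℝ)
    (hY : IsLevyProcess Y P) (hZ : IsLevyProcess Z P)
    (hYZ : IndepFun (fun ω t => Y t ω) (fun ω t => Z t ω) P)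
    (hX : IsAlternatingProcess p q Y Z X P)
    (hY1 : Integrable (Y 1) P) (hZ1 : Integrable (Z 1) P) :
    Integrable (fun ω => Y q ω + Z (p - q) ω) P ∧
      (IsRecurrentProcess X P ↔ ∫ ω, (Y q ω + Z (p - q) ω) ∂P = 0) :=
  ⟨(hY.integrable hY1 q).add (hZ.integrable hZ1 (p - q)),
    hX.integral_eq_zero_of_isRecurrentProcess hq hqp hY hZ hYZ hY1 hZ1,
    hX.isRecurrentProcess hq hqp hY hZ hYZ hY1 hZ1⟩
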